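/- \textbf{Setting.} $n$ pursuers move in the plane with constant speeds $V_i>0$ according to $\dot x_i=V_i\cos\gamma_i$, $\dot y_i=V_i\sin\gamma_i$, $\dot\gamma_i=a_i/V_i$, towards a stationary target $T$. Let $R_i$ be the distance from pursuer $i$ to $T$, let $\theta_i\in(-\pi,\pi]$ be its lead angle (the oriented angle from its heading to the line of sight to $T$), let $$\tilde t_i=\frac{R_i\theta_i}{V_i\sin\theta_i},\qquad a_i'=\frac{2V_i^2\sin\theta_i}{R_i},$$ and assume $R_i(0)>0$ and $\theta_i(0)\notin\{0,\pi\}$ for all $i$. The communication digraph $\mathcal G(t)$, $t\ge 0$, on the nodes $\{1,\dots,n\}$ is piecewise constant and right-continuous, with finitely many switches in each bounded time interval; an edge $(i,j)$ makes $j$ an out-neighbour of $i$. \textbf{Guidance law.} $a_i=0$ if $\tilde t_i<\tilde t_j$ for some out-neighbour $j$ of $i$, and $a_i=a_i'$ otherwise. Trajectories are Carath\'eodory solutions ($\gamma_i$ absolutely continuous, the equations for $\gamma_i$ and the law holding for almost every $t$) up to the first interception, with continuous paths. Sliding motions are admitted as well: at an instant at which $\tilde t_i$ equals the largest $\tilde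 t_j$ of its out-neighbours, and some pursuer reachable from $i$ along edges $(p,q)$ with $\tilde t_p=\tilde t_q$ has an out-neighbour with a strictly larger $\tilde t$ than its own, $a_i=u\,a_i'$ with any $u\in[0,1]$ is allowed. \textbf{Losses of reachability.} Let $l$ be a leader, i.e. $\tilde t_l(0)=\max_i\tilde t_i(0)$. Suppose there is a finite (possibly empty) or infinite sequence of instants $t_m\ge 0$ and durations $\delta_m>0$, with $t_m+\delta_m<t_{m+1}$, such that $l$ is not globally reachable in $\mathcal G(t)$ for $t\in[t_m,t_m+\delta_m)$ (there $\mathcal G$ is denoted $\mathcal G^d_m$), and is globally reachable (every other node has a directed path to it) at all remaining times $t\ge0$. \textbf{First interceptor.} For a digraph $\mathcal G$, let $C(\mathcal G)$ be its condensation graph, whose nodes are the strongly connected components of $\mathcal G$, and $\mathcal S(\mathcal G)$ the set of the sinks and singletons (isolated nodes) of $C(\mathcal G)$. For each $m$ let $P_m$ be the set of all nodes $s$ for which there is a component $k\in\mathcal S(\mathcal G(t_m))$ such that $s\in k$ and $\tilde t_s(t_m)=\max_{j\in k}\tilde t_j(t_m)$, and let $f=f_m\in P_m$ minimize $\tilde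 t_i(t_m)$ over $i\in P_m$. \textbf{Theorem.} Suppose that, for every $m$ such that no pursuer has reached $T$ up to and including time $t_m$: \begin{itemize} \item no new sink or singleton is formed during $[t_m,t_m+\delta_m)$, i.e. for every $t$ in this interval each component in $\mathcal S(\mathcal G(t))$ contains a component in $\mathcal S(\mathcal G(t_m))$ (so that the number of sinks and singletons never exceeds its value at $t_m$); \item $\delta_m<\tilde t_{f_m}(t_m)$. \end{itemize} Then the pursuers reach consensus in finite time and intercept the target simultaneously at time $t_f=\tilde t_l(0)$: there is $t_c\in[0,t_f)$ such that $\tilde t_i(t)=\tilde t_j(t)$ for all $i,j$ and all $t\in[t_c,t_f)$; no pursuer is at $T$ at any time $t\in[0,t_f)$; and every pursuer is at $T$ at time $t_f$. -/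

import Mathlib

open Set MeasureTheory

noncomputable section

namespace Interception

/-! ### Digraphs, global reachability, condensation graph -/

section Graphs

variable {V : Type} (G : Digraph V)

/-- There is a directed (possibly trivial) path from `i` to `j`. -/
def Reach (i j : V) : Prop := Relation.ReflTransGen G.Adj i j

/-- `l` is globally reachable: every node has a directed path to `l`. -/
def GloballyReachable (l : V) : Prop := ∀ j, Reach G j l

/-- Two nodes are equivalent when each can be reached from the other; the classes are the
strongly connected components of `G`. -/
def sccSetoid : Setoid V where
  r i j := Reach G i j ∧ Reach G j i
  iseqv :=
    { refl := fun _ => ⟨Relation.ReflTransGen.refl, Relation.ReflTransGen.refl⟩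
      symm := fun h => ⟨h.2, h.1⟩
      trans := fun h h' => ⟨h.1.trans h'.1, h'.2.trans h.2⟩ }

/-- The nodes of the condensation graph: the strongly connected components of `G`. -/
def CondNode : Type := Quotient (sccSetoid G)

/-- The set of the nodes of `G` that are condensed to the node `k` of the condensation graph. -/
def condFiber (k : CondNode G) : Set V := {i | (Quotient.mk (sccSetoid G) i : CondNode G) = k}

/-- The condensation graph: an edge joins two distinct components when some edge of `G` does
(so self-loops of `G` play no role). -/
def condensation : Digraph (CondNode G) where
  Adj k k' := k ≠ k' ∧ ∃ i ∈ condFiber G k, ∃ j ∈ condFiber G k', G.Adj i j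

/-- A sink of the condensation graph: no outgoing edge. -/
def IsSink (k : CondNode G) : Prop := ∀ k', ¬ (condensation G).Adj k k'

/-- A singleton of the condensation graph: an isolated node, with no edge at all. -/
def IsSingleton (k : CondNode G) : Prop :=
  ∀ k', ¬ (condensation G).Adj k k' ∧ ¬ (condensation G).Adj k' k

/-- The set of all sinks and singletons of the condensation graph. -/
def sinksSingletons : Set (CondNode G) := {k | IsSink G k ∨ IsSingleton G k}

/-- The set of local leaders: for every sink or singleton of the condensation graph, the nodes
of that component at which `τ` is largest. -/
def localLeaders (τ : V → ℝ) : Set V :=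
  {s | ∃ k ∈ sinksSingletons G, s ∈ condFiber G k ∧ ∀ j ∈ condFiber G k, τ j ≤ τ s}

/-- `f` is a "first interceptor": a local leader with the smallest value of `τ`. -/
def IsFirstInterceptor (τ : V → ℝ) (f : V) : Prop :=
  f ∈ localLeaders G τ ∧ ∀ p ∈ localLeaders G τ, τ f ≤ τ p

/-- Passing from `G` to `G'` creates no new sink or singleton in the condensation graph: every
sink or singleton component of `G'` contains one of `G`. (Distinct components being disjoint,
the number of sinks and singletons is then not larger for `G'` than for `G`.) -/
def NoNewSinks (G G' : Digraph V) : Prop :=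
  ∀ k' ∈ sinksSingletons G', ∃ k ∈ sinksSingletons G, condFiber G k ⊆ condFiber G' k'

/-- `i` is not behind any of its out-neighbours: `τ i ≥ τ j` for every out-neighbour `j`. -/
def NotBehind (τ : V → ℝ) (i : V) : Prop := ∀ j, G.Adj i j → τ j ≤ τ i

/-- `k` can be reached from `i` along edges whose ends have the same value of `τ`. -/
def TieReach (τ : V → ℝ) (i k : V) : Prop :=
  Relation.ReflTransGen (fun p q => G.Adj p q ∧ τ q = τ p) i k

/-- The guidance law at one instant. Here `τ` are the estimated times of interception, `a` the
lateral accelerations applied, and `a'` those of the circular paths.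

The law proper says: `a i = 0` if `τ i < τ j` for some out-neighbour `j`, and `a i = a' i`
otherwise. Every `a` obeying it at the given instant satisfies the three clauses below. They are
more permissive in one situation only: if `i` is tied with the largest `τ` of its out-neighbours
and a chain of ties leads from `i` to a pursuer that is itself behind an out-neighbour (and hence
flies straight), then `i` may have to chatter between the two modes so as to stay tied; the
averaged command `u * a' i` with `0 ≤ u ≤ 1` represents this sliding motion. -/
def GuidanceLaw (τ a a' : V → ℝ) : Prop :=
  (∀ i, (∃ j, G.Adj i j ∧ τ i < τ j) → a i = 0) ∧
  (∀ i, (∀ k, TieReach G τ i k → NotBehind G τ k) → a i = a' i) ∧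
  (∀ i, NotBehind G τ i → ∃ u ∈ Icc (0 : ℝ) 1, a i = u * a' i)

end Graphs

/-! ### Switching graphs -/

/-- A switching graph with fixed nodes: right-continuous and piecewise constant in time, with
finitely many switches in every bounded time interval. -/
def IsSwitching {V : Type} (G : ℝ → Digraph V) : Prop :=
  ∀ T : ℝ, ∃ F : Finset ℝ, ∀ s t : ℝ, 0 ≤ s → s ≤ t → t ≤ T →
    (∀ r ∈ F, ¬ (s < r ∧ r ≤ t)) → G s = G t

/-- `t m` (`m < N`, where `N` may be infinite) are the successive instants at which `l` loses its
global reachability and `δ m` are the durations of these losses: `l` is not globally reachable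
during `[t m, t m + δ m)`, and is globally reachable at all other times. -/
structure IsLossSequence {V : Type} (G : ℝ → Digraph V) (l : V) (N : ℕ∞) (t δ : ℕ → ℝ) :
    Prop where
  nonneg : ∀ m : ℕ, (m : ℕ∞) < N → 0 ≤ t m
  duration_pos : ∀ m : ℕ, (m : ℕ∞) < N → 0 < δ m
  lt_next : ∀ m : ℕ, ((m + 1 : ℕ) : ℕ∞) < N → t m + δ m < t (m + 1)
  disconnected : ∀ m : ℕ, (m : ℕ∞) < N → ∀ s ∈ Ico (t m) (t m + δ m),
    ¬ GloballyReachable (G s) l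
  connected : ∀ s : ℝ, 0 ≤ s → (∀ m : ℕ, (m : ℕ∞) < N → s ∉ Ico (t m) (t m + δ m)) →
    GloballyReachable (G s) l

/-! ### The engagement -/

/-- The data of an engagement of `n` pursuers with a stationary target: the speeds, the position
of the target, and, as functions of time, positions, heading angles and lateral accelerations. -/
structure Engagement (n : ℕ) where
  V : Fin n → ℝ
  V_pos : ∀ i, 0 < V i
  xT : ℝ
  yT : ℝ
  x : Fin n → ℝ → ℝ
  y : Fin n → ℝ → ℝ
  γ : Fin n → ℝ → ℝ
  a : Fin n → ℝ → ℝ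

namespace Engagement

variable {n : ℕ} (E : Engagement n)

/-- The distance from pursuer `i` to the target. -/
def R (i : Fin n) (t : ℝ) : ℝ := Real.sqrt ((E.xT - E.x i t) ^ 2 + (E.yT - E.y i t) ^ 2)

/-- The lead angle in `(-π, π]`: the oriented angle from the heading direction of pursuer `i`
to the line of sight from pursuer `i` to the target. -/
def θ (i : Fin n) (t : ℝ) : ℝ :=
  Complex.arg ((((E.xT - E.x i t : ℝ) : ℂ) + ((E.yT - E.y i t : ℝ) : ℂ) * Complex.I) *
    Complex.exp (-((E.γ i t : ℝ) : ℂ) * Complex.I))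

/-- The estimated time of interception. -/
def tEst (t : ℝ) (i : Fin n) : ℝ := E.R i t * E.θ i t / (E.V i * Real.sin (E.θ i t))

/-- The lateral acceleration that steers pursuer `i` along a circle to the target. -/
def aCirc (t : ℝ) (i : Fin n) : ℝ := 2 * E.V i ^ 2 * Real.sin (E.θ i t) / E.R i t

/-- Pursuer `i` is at the target at time `t`. -/
def AtTarget (i : Fin n) (t : ℝ) : Prop := E.x i t = E.xT ∧ E.y i t = E.yT

/-- No pursuer has reached the target up to and including time `t`. -/
def InProgress (t : ℝ) : Prop := ∀ s ∈ Icc (0 : ℝ) t, ∀ i, ¬ E.AtTarget i s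

/-- A leader at time `t`: a pursuer with the largest estimated time of interception. -/
def IsLeader (l : Fin n) (t : ℝ) : Prop := ∀ i, E.tEst t i ≤ E.tEst t l

/-- The unicycle kinematics, in the sense of Carathéodory, as long as no pursuer has reached the
target. (Paths are continuous; nothing else is required after the first interception.) -/
structure Kinematics : Prop where
  continuousOn_x : ∀ i, ContinuousOn (E.x i) (Ici 0)
  continuousOn_y : ∀ i, ContinuousOn (E.y i) (Ici 0)
  deriv_x : ∀ i t, 0 < t → E.InProgress t → HasDerivAt (E.x i) (E.V i * Real.cos (E.γ i t)) t
  deriv_y : ∀ i t, 0 < t → E.InProgress t → HasDerivAt (E.y i) (E.V i * Real.sin (E.γ i t)) t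
  absCont_γ : ∀ i t, 0 < t → E.InProgress t → AbsolutelyContinuousOnInterval (E.γ i) 0 t
  deriv_γ : ∀ i, ∀ᵐ t : ℝ, 0 < t → E.InProgress t → HasDerivAt (E.γ i) (E.a i t / E.V i) t

/-- The pursuers move under the guidance law with communication graph `G t` at time `t`, at
almost every time before the first interception. -/
def UnderGuidanceLaw (G : ℝ → Digraph (Fin n)) : Prop :=
  ∀ᵐ t : ℝ, 0 < t → E.InProgress t →
    GuidanceLaw (G t) (E.tEst t) (fun i => E.a i t) (E.aCirc t)

end Engagement

end Interception

end

/-! Put `z_i(t) = t + tEst t i`, the predicted arrival time. In the frame of the heading, the line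
of sight has coordinates `along` and `across`, and the command `u * aCirc` gives `z_i' = 2 (1 - u)
(1 - |θ| cot |θ|)` as long as `across` is nonzero, which a Grönwall estimate guarantees. Hence `z_i`
never decreases (`add_tEst_mono`) and is stationary on the circular path. A pursuer of largest
`tEst` must fly the circle, so `max z_i` is constant (`add_tEst_le_of_isLeader`), equal to `tEst 0
l`.

The second ingredient is `not_behind_until`: a pursuer with `z_j ≤ T` cannot stay behind a fixed
out-neighbour throughout an interval ending at `T`. It would fly straight with constant nonzero
`across`, whereas `|across| ≤ R ≤ V * tEst ≤ V * (T - t)` tends to zero. Since the graph is constant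
just before `T`, no edge then leaves a set of pursuers with `z ≤ T` that end up behind all the
others.

Suppose that the first interception occurs at `T < tEst 0 l`. The interceptor belongs to the set of
pursuers with `z ≤ T` throughout `[0, T)`, which no edge leaves just before `T`. Yet some path
leaves it (`reach_before`): it goes to `l`, or, during a loss, to a former local leader `j`, for
which `z_j ≥ t m + tEst (t m) (f m) > t m + δ m ≥ T`. This is absurd. The same argument at `T = tEst
0 l`, for the pursuers whose `z` stays below `T`, gives consensus. Finally `R ≤ V * (T - t)` brings
everybody to the target at `T`. -/

namespace AbsolutelyContinuousOnInterval

/-! ### Absolutely continuous functions: closure properties and monotonicity -/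

variable {X Y : Type*} [PseudoMetricSpace X] [PseudoMetricSpace Y] {a b : ℝ}

theorem comp_lipschitzOnWith {f : ℝ → X} {g : X → Y} {s : Set X} {K : NNReal}
    (hf : AbsolutelyContinuousOnInterval f a b) (hg : LipschitzOnWith K g s)
    (hfs : MapsTo f (uIcc a b) s) : AbsolutelyContinuousOnInterval (fun t => g (f t)) a b := by
  rw [absolutelyContinuousOnInterval_iff] at hf ⊢
  intro ε hε
  -- `K + 1` rather than `K`, since `K` may vanish.
  obtain ⟨δ, hδ, h⟩ := hf (ε / (K + 1)) (by positivity)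
  refine ⟨δ, hδ, fun E hE hlt => ?_⟩
  have h1 := h E hE hlt
  calc ∑ i ∈ Finset.range E.1, dist (g (f (E.2 i).1)) (g (f (E.2 i).2))
      ≤ ∑ i ∈ Finset.range E.1, K * dist (f (E.2 i).1) (f (E.2 i).2) :=
        Finset.sum_le_sum fun i hi =>
          hg.dist_le_mul _ (hfs (hE.1 i hi).1) _ (hfs (hE.1 i hi).2)
    _ = K * ∑ i ∈ Finset.range E.1, dist (f (E.2 i).1) (f (E.2 i).2) := by
        rw [Finset.mul_sum]
    _ ≤ (K + 1) * ∑ i ∈ Finset.range E.1, dist (f (E.2 i).1) (f (E.2 i).2) := by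
        gcongr
        linarith
    _ < (K + 1) * (ε / (K + 1)) := by gcongr
    _ = ε := by field_simp

theorem congr {f g : ℝ → X} (hf : AbsolutelyContinuousOnInterval f a b)
    (hfg : EqOn f g (uIcc a b)) : AbsolutelyContinuousOnInterval g a b := by
  rw [absolutelyContinuousOnInterval_iff] at hf ⊢
  intro ε hε
  obtain ⟨δ, hδ, h⟩ := hf ε hε
  refine ⟨δ, hδ, fun E hE hlt => ?_⟩
  convert! h E hE hlt using 1
  refine Finset.sum_congr rfl fun i hi => ?_
  rw [hfg (hE.1 i hi).1, hfg (hE.1 i hi).2]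

/-- A `C¹` function of a real absolutely continuous function is absolutely continuous. -/
theorem comp_contDiffOn {f g : ℝ → ℝ} (hf : AbsolutelyContinuousOnInterval f a b)
    (hg : ContDiffOn ℝ 1 g (f '' uIcc a b)) :
    AbsolutelyContinuousOnInterval (fun t => g (f t)) a b := by
  -- The image of the interval is compact and convex, so a `C¹` function is Lipschitz on it.
  have hconv : Convex ℝ (f '' uIcc a b) :=
    (isPreconnected_uIcc.image f hf.continuousOn).ordConnected.convex
  obtain ⟨K, hK⟩ := hg.exists_lipschitzOnWith (by decide) hconv
    (isCompact_uIcc.image_of_continuousOn hf.continuousOn)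
  exact hf.comp_lipschitzOnWith hK (mapsTo_image f _)

theorem const_sub {f : ℝ → ℝ} (c : ℝ) (hf : AbsolutelyContinuousOnInterval f a b) :
    AbsolutelyContinuousOnInterval (fun t => c - f t) a b :=
  hf.comp_contDiffOn (g := fun x => c - x) (by fun_prop)

theorem fun_inv {f : ℝ → ℝ} (hf : AbsolutelyContinuousOnInterval f a b)
    (h0 : ∀ t ∈ uIcc a b, f t ≠ 0) : AbsolutelyContinuousOnInterval (fun t => (f t)⁻¹) a b := by
  refine hf.comp_contDiffOn (g := fun x => x⁻¹) (contDiffOn_id.inv ?_)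
  rintro _ ⟨t, ht, rfl⟩
  exact h0 t ht

theorem fun_abs {f : ℝ → ℝ} (hf : AbsolutelyContinuousOnInterval f a b) :
    AbsolutelyContinuousOnInterval (fun t => |f t|) a b :=
  hf.comp_lipschitzOnWith (g := fun x : ℝ => |x|) (K := 1) (s := univ)
    (LipschitzWith.of_dist_le_mul fun x y => by
      simpa [Real.dist_eq] using abs_abs_sub_abs_le x y).lipschitzOnWith (mapsTo_univ _ _)

theorem fun_max {f g : ℝ → ℝ} (hf : AbsolutelyContinuousOnInterval f a b)
    (hg : AbsolutelyContinuousOnInterval g a b) :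
    AbsolutelyContinuousOnInterval (fun t => max (f t) (g t)) a b := by
  refine (((hf.fun_add hg).fun_add (hf.fun_sub hg).fun_abs).const_mul (1 / 2)).congr ?_
  intro t _
  rcases le_total (f t) (g t) with h | h
  · simp only [max_eq_right h, abs_of_nonpos (sub_nonpos.2 h)]; ring
  · simp only [max_eq_left h, abs_of_nonneg (sub_nonneg.2 h)]; ring

theorem fun_sup' {ι : Type*} {s : Finset ι} (hs : s.Nonempty) {f : ι → ℝ → ℝ}
    (hf : ∀ i, AbsolutelyContinuousOnInterval (f i) a b) :
    AbsolutelyContinuousOnInterval (fun t => s.sup' hs fun i => f i t) a b := by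
  classical
  induction hs using Finset.Nonempty.cons_induction with
  | singleton i => simpa using hf i
  | cons i s hi hs ih => 
    exact ((hf i).fun_max ih).congr fun t _ => (Finset.sup'_cons hs fun j => f j t).symm

/-- The fundamental theorem of calculus for absolutely continuous functions. It is needed because
the law, hence the derivative, is available only at almost every time. -/
theorem le_of_ae_deriv_nonneg {f : ℝ → ℝ} (hab : a ≤ b)
    (hf : AbsolutelyContinuousOnInterval f a b)
    (h : ∀ᵐ t : ℝ, t ∈ Ioo a b → ∃ f', HasDerivAt f f' t ∧ 0 ≤ f') : f a ≤ f b := by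
  have h1 := hf.integral_deriv_eq_sub
  have h2 : 0 ≤ ∫ t in a..b, deriv f t := by
    refine intervalIntegral.integral_nonneg_of_ae_restrict hab ?_
    rw [Filter.EventuallyLE, ← Measure.restrict_congr_set Ioo_ae_eq_Icc,
      ae_restrict_iff' measurableSet_Ioo]
    filter_upwards [h] with t ht htt
    obtain ⟨f', hf', h0⟩ := ht htt
    simpa [hf'.deriv] using h0
  linarith

theorem eq_of_ae_deriv_eq_zero {f : ℝ → ℝ} (hab : a ≤ b)
    (hf : AbsolutelyContinuousOnInterval f a b)
    (h : ∀ᵐ t : ℝ, t ∈ Ioo a b → HasDerivAt f 0 t) : f a = f b := by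
  refine le_antisymm (hf.le_of_ae_deriv_nonneg hab ?_) ?_
  · filter_upwards [h] with t ht htt using ⟨0, ht htt, le_rfl⟩
  · have := hf.fun_neg.le_of_ae_deriv_nonneg hab ?_
    · simpa using this
    · filter_upwards [h] with t ht htt using ⟨0, by simpa using (ht htt).fun_neg, le_rfl⟩

end AbsolutelyContinuousOnInterval

/-- A continuous function with a bounded derivative is absolutely continuous. -/
theorem ContinuousOn.absolutelyContinuousOnInterval_of_hasDerivAt {f f' : ℝ → ℝ} {a b C : ℝ}
    (hab : a ≤ b) (hf : ContinuousOn f (Icc a b)) (hf' : ∀ t ∈ Ioo a b, HasDerivAt f (f' t) t)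
    (hC : ∀ t ∈ Ioo a b, |f' t| ≤ C) : AbsolutelyContinuousOnInterval f a b := by
  have hlip : LipschitzOnWith (Real.toNNReal C) f (Ioo a b) :=
    (convex_Ioo a b).lipschitzOnWith_of_nnnorm_hasDerivWithin_le
      (fun t ht => (hf' t ht).hasDerivWithinAt) fun t ht => by
        rw [← NNReal.coe_le_coe, coe_nnnorm, Real.norm_eq_abs]
        exact (hC t ht).trans (Real.le_coe_toNNReal C)
  rcases hab.eq_or_lt with rfl | hab
  · exact LipschitzOnWith.absolutelyContinuousOnInterval (K := 0) (by
      intro x hx y hy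
      simp only [uIcc_self, mem_singleton_iff] at hx hy
      simp [hx, hy])
  · have := LipschitzOnWith.closure (s := Ioo a b) (f := f) (K := Real.toNNReal C)
      (by rwa [closure_Ioo hab.ne]) hlip
    rw [closure_Ioo hab.ne, ← uIcc_of_le hab.le] at this
    exact this.absolutelyContinuousOnInterval

/-- If the functions attaining a finite maximum at a point have derivative zero there, so has the
maximum, provided that it is differentiable. -/
theorem HasDerivAt.sup'_of_attained {ι : Type*} {s : Finset ι} (hs : s.Nonempty)
    {f : ι → ℝ → ℝ} {t : ℝ} (hdiff : DifferentiableAt ℝ (fun r => s.sup' hs fun i => f i r) t)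
    (h : ∀ i ∈ s, (∀ j ∈ s, f j t ≤ f i t) → HasDerivAt (f i) 0 t) :
    HasDerivAt (fun r => s.sup' hs fun i => f i r) 0 t := by
  obtain ⟨i, hi, hit⟩ := s.exists_mem_eq_sup' hs fun i => f i t
  have hfi := h i hi fun j hj => hit ▸ Finset.le_sup' (fun i => f i t) hj
  -- The maximum minus a function attaining it is nonnegative and vanishes at `t`, so the two
  -- derivatives there agree.
  have hmin : IsLocalMin (fun r => s.sup' hs (fun i => f i r) - f i r) t := by
    refine Filter.Eventually.of_forall fun r => ?_
    simp only [hit, sub_self, sub_nonneg]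
    exact Finset.le_sup' (fun i => f i r) hi
  have h0 := hmin.hasDerivAt_eq_zero (hdiff.hasDerivAt.sub hfi)
  rw [sub_zero] at h0
  simpa [h0] using hdiff.hasDerivAt

/-- With `x = cot φ`, `0 < φ < π`, this is `φ cot φ ≤ 1`; for acute `φ` it follows from `φ ≤ tan φ`.
It gives the sign of the derivative of `t + tEst`. -/
theorem Real.pi_div_two_sub_arctan_mul_le (x : ℝ) : (Real.pi / 2 - Real.arctan x) * x ≤ 1 := by
  rcases le_or_gt x 0 with hx | hx
  · have := Real.arctan_lt_pi_div_two x
    nlinarith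
  · have h1 : Real.pi / 2 - Real.arctan x = Real.arctan x⁻¹ := by
      rw [Real.arctan_inv_of_pos hx]
    have h2 : Real.arctan x⁻¹ ≤ x⁻¹ := by
      have h3 := Real.le_tan (Real.arctan_nonneg.2 (inv_nonneg.2 hx.le))
        (Real.arctan_lt_pi_div_two x⁻¹)
      rwa [Real.tan_arctan] at h3
    rw [h1]
    calc Real.arctan x⁻¹ * x ≤ x⁻¹ * x := by gcongr
      _ = 1 := inv_mul_cancel₀ hx.ne'

/-! ### Guidance law and line of sight in the frame of the heading -/

namespace Interception

namespace GuidanceLaw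

variable {V : Type} {G : Digraph V} {τ a a' : V → ℝ}

/-- Straight flight is `u = 0`, so one parameter covers straight, circular and sliding motion. -/
theorem exists_eq_mul (h : GuidanceLaw G τ a a') (i : V) :
    ∃ u ∈ Icc (0 : ℝ) 1, a i = u * a' i := by
  by_cases hi : NotBehind G τ i
  · exact h.2.2 i hi
  · simp only [NotBehind, not_forall, not_le] at hi
    obtain ⟨j, hj, hlt⟩ := hi
    exact ⟨0, by simp, by simpa using h.1 i ⟨j, hj, hlt⟩⟩

/-- Along a chain of ties `τ` keeps its maximal value, so nobody on the chain is behind and the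
sliding clause leaves no freedom. -/
theorem eq_of_forall_le (h : GuidanceLaw G τ a a') {i : V} (hi : ∀ j, τ j ≤ τ i) :
    a i = a' i := by
  refine h.2.1 i fun k hk => ?_
  have : τ k = τ i := by
    induction hk with
    | refl => rfl
    | tail _ hpq ih => exact hpq.2.trans ih
  exact fun j _ => this ▸ hi j

end GuidanceLaw

namespace Engagement

variable {n : ℕ} (E : Engagement n)

/-- The component of the line of sight along the heading. -/
noncomputable def along (i : Fin n) (t : ℝ) : ℝ :=
  (E.xT - E.x i t) * Real.cos (E.γ i t) + (E.yT - E.y i t) * Real.sin (E.γ i t)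

/-- The component of the line of sight across the heading. -/
noncomputable def across (i : Fin n) (t : ℝ) : ℝ :=
  (E.yT - E.y i t) * Real.cos (E.γ i t) - (E.xT - E.x i t) * Real.sin (E.γ i t)

variable {E} {i : Fin n} {t T : ℝ}

theorem θ_eq_arg : E.θ i t = Complex.arg ⟨E.along i t, E.across i t⟩ := by
  have h : Complex.exp (-((E.γ i t : ℝ) : ℂ) * Complex.I) =
      ⟨Real.cos (E.γ i t), -Real.sin (E.γ i t)⟩ := by
    apply Complex.ext <;> simp [Complex.exp_re, Complex.exp_im]
  rw [θ, h]
  congr 1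
  apply Complex.ext
  · simp [along]
  · simp [across]
    ring

theorem along_sq_add_across_sq :
    E.along i t ^ 2 + E.across i t ^ 2 = (E.xT - E.x i t) ^ 2 + (E.yT - E.y i t) ^ 2 := by
  simp only [along, across]
  linear_combination ((E.xT - E.x i t) ^ 2 + (E.yT - E.y i t) ^ 2) *
    Real.sin_sq_add_cos_sq (E.γ i t)

theorem R_sq : E.R i t ^ 2 = E.along i t ^ 2 + E.across i t ^ 2 := by
  rw [along_sq_add_across_sq, R, Real.sq_sqrt (by positivity)]

theorem R_eq_norm : E.R i t = ‖(⟨E.along i t, E.across i t⟩ : ℂ)‖ := by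
  rw [Complex.norm_def, Complex.normSq_mk, ← sq, ← sq, along_sq_add_across_sq, R]

theorem R_nonneg : 0 ≤ E.R i t := Real.sqrt_nonneg _

theorem R_eq_zero_iff : E.R i t = 0 ↔ E.AtTarget i t := by
  rw [R, Real.sqrt_eq_zero (by positivity), AtTarget]
  constructor
  · intro h
    constructor <;> nlinarith [sq_nonneg (E.xT - E.x i t), sq_nonneg (E.yT - E.y i t)]
  · rintro ⟨h, h'⟩
    simp [h, h']

theorem R_pos (h : ¬ E.AtTarget i t) : 0 < E.R i t :=
  R_nonneg.lt_of_ne' fun h' => h (R_eq_zero_iff.1 h')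

theorem R_mul_sin : E.R i t * Real.sin (E.θ i t) = E.across i t := by
  rw [R_eq_norm, θ_eq_arg, Complex.norm_mul_sin_arg]

theorem R_pos_of_across (h : E.across i t ≠ 0) : 0 < E.R i t :=
  R_nonneg.lt_of_ne' fun h' => h (by rw [← R_mul_sin, h', zero_mul])

theorem abs_across_le : |E.across i t| ≤ E.R i t := by
  rw [← R_mul_sin, abs_mul, abs_of_nonneg R_nonneg]
  exact mul_le_of_le_one_right R_nonneg (Real.abs_sin_le_one _)

theorem abs_θ_le_pi : |E.θ i t| ≤ Real.pi := by
  rw [θ_eq_arg]; exact Complex.abs_arg_le_pi _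

theorem abs_sin_θ : |Real.sin (E.θ i t)| = Real.sin |E.θ i t| :=
  Real.abs_sin_eq_sin_abs_of_abs_le_pi abs_θ_le_pi

theorem tEst_eq_abs : E.tEst t i =
    E.R i t * |E.θ i t| / (E.V i * Real.sin |E.θ i t|) := by
  rw [tEst]
  rcases abs_choice (E.θ i t) with h | h <;> rw [h]
  rw [Real.sin_neg, mul_neg, mul_neg, neg_div_neg_eq]

theorem sin_abs_θ_pos (h : E.across i t ≠ 0) : 0 < Real.sin |E.θ i t| := by
  rw [← abs_sin_θ, abs_pos]
  intro h'
  exact h (by rw [← R_mul_sin, h', mul_zero])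

/-- From `sin x ≤ x`: the circular arc is at least as long as its chord. -/
theorem R_le_mul_tEst (h : E.across i t ≠ 0) : E.R i t ≤ E.V i * E.tEst t i := by
  have hV := E.V_pos i
  have hs := sin_abs_θ_pos h
  have h1 : Real.sin |E.θ i t| ≤ |E.θ i t| := Real.sin_le (abs_nonneg _)
  rw [tEst_eq_abs, mul_div_assoc', mul_div_mul_left _ _ hV.ne', le_div_iff₀ hs]
  exact mul_le_mul_of_nonneg_left h1 R_nonneg

theorem tEst_pos (h : E.across i t ≠ 0) : 0 < E.tEst t i :=
  pos_of_mul_pos_right ((R_pos_of_across h).trans_le (R_le_mul_tEst h)) (E.V_pos i).le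

/-- Jordan's inequality `2 x / π ≤ sin x`, as the lead angle is at most a right angle. -/
theorem tEst_le_of_along_pos (h : E.across i t ≠ 0) (h' : 0 < E.along i t) :
    E.V i * E.tEst t i ≤ Real.pi / 2 * E.R i t := by
  have hV := E.V_pos i
  have hs := sin_abs_θ_pos h
  have h2 : |E.θ i t| ≤ Real.pi / 2 := by
    rw [θ_eq_arg, Complex.abs_arg_le_pi_div_two_iff]
    exact h'.le
  have h1 := Real.mul_le_sin (abs_nonneg (E.θ i t)) h2
  rw [tEst_eq_abs, mul_div_assoc', mul_div_mul_left _ _ hV.ne', div_le_iff₀ hs]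
  have h3 : |E.θ i t| ≤ Real.pi / 2 * Real.sin |E.θ i t| := by
    calc |E.θ i t| = Real.pi / 2 * (2 / Real.pi * |E.θ i t|) := by
          field_simp [Real.pi_ne_zero]
      _ ≤ _ := by gcongr
  calc E.R i t * |E.θ i t| ≤ E.R i t * (Real.pi / 2 * Real.sin |E.θ i t|) :=
        mul_le_mul_of_nonneg_left h3 R_nonneg
    _ = _ := by ring

/-- Expresses the angle through `arctan` instead of `Complex.arg`, which makes it smooth in `along`
and `|across|` wherever `across` is nonzero. -/
theorem abs_θ_eq (h : E.across i t ≠ 0) :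
    |E.θ i t| = Real.pi / 2 - Real.arctan (E.along i t * |E.across i t|⁻¹) := by
  have hR := R_pos_of_across h
  have h0 : 0 < |E.across i t| := abs_pos.2 h
  have h1 : |E.θ i t| = Real.arccos (E.along i t / E.R i t) := by
    rw [θ_eq_arg, R_eq_norm]
    rcases lt_or_gt_of_ne h with h | h
    · rw [Complex.arg_of_im_neg h, abs_neg, abs_of_nonneg (Real.arccos_nonneg _)]
    · rw [Complex.arg_of_im_pos h, abs_of_nonneg (Real.arccos_nonneg _)]
  have h2 : Real.sqrt (1 + (E.along i t * |E.across i t|⁻¹) ^ 2) =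
      E.R i t * |E.across i t|⁻¹ := by
    rw [Real.sqrt_eq_iff_eq_sq (by positivity) (by positivity), mul_pow, mul_pow, R_sq, inv_pow,
      sq_abs]
    field_simp
    ring
  rw [h1, Real.arctan_eq_arcsin, h2, Real.arccos_eq_pi_div_two_sub_arcsin,
    mul_div_mul_right _ _ (inv_ne_zero h0.ne')]

theorem tEst_eq (h : E.across i t ≠ 0) : E.tEst t i =
    (E.V i)⁻¹ * ((E.along i t ^ 2 + E.across i t ^ 2) *
      (Real.pi / 2 - Real.arctan (E.along i t * |E.across i t|⁻¹)) * |E.across i t|⁻¹) := by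
  have hR := R_pos_of_across h
  have hV := E.V_pos i
  have hs := sin_abs_θ_pos h
  rw [← abs_θ_eq h, ← R_sq, tEst_eq_abs, ← R_mul_sin, abs_mul, abs_sin_θ, abs_of_pos hR]
  field_simp

theorem aCirc_div : E.aCirc t i / E.V i =
    2 * E.V i / (E.along i t ^ 2 + E.across i t ^ 2) * E.across i t := by
  have hV := E.V_pos i
  rw [← R_sq, aCirc]
  rcases (R_nonneg (E := E) (i := i) (t := t)).eq_or_lt with h | h
  · simp [← h]
  · rw [← R_mul_sin]
    field_simp

theorem InProgress.mono {s : ℝ} (h : E.InProgress t) (hs : s ≤ t) : E.InProgress s :=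
  fun r hr => h r ⟨hr.1, hr.2.trans hs⟩

end Engagement
end Interception

/-! ### Equations of motion and the derivative of the estimated time -/

namespace Interception
namespace Engagement

variable {n : ℕ} {E : Engagement n} {i : Fin n} {t T : ℝ}

theorem hasDerivAt_along {ω : ℝ} (hx : HasDerivAt (E.x i) (E.V i * Real.cos (E.γ i t)) t)
    (hy : HasDerivAt (E.y i) (E.V i * Real.sin (E.γ i t)) t) (hγ : HasDerivAt (E.γ i) ω t) :
    HasDerivAt (E.along i) (-E.V i + ω * E.across i t) t := by
  have h := ((hx.const_sub E.xT).mul hγ.cos).add ((hy.const_sub E.yT).mul hγ.sin)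
  refine h.congr_deriv ?_
  simp only [across]
  linear_combination -E.V i * Real.sin_sq_add_cos_sq (E.γ i t)

theorem hasDerivAt_across {ω : ℝ} (hx : HasDerivAt (E.x i) (E.V i * Real.cos (E.γ i t)) t)
    (hy : HasDerivAt (E.y i) (E.V i * Real.sin (E.γ i t)) t) (hγ : HasDerivAt (E.γ i) ω t) :
    HasDerivAt (E.across i) (-ω * E.along i t) t := by
  have h := ((hy.const_sub E.yT).mul hγ.cos).sub ((hx.const_sub E.xT).mul hγ.sin)
  refine h.congr_deriv ?_
  simp only [along]
  ring

/-- The coefficient of the rotation rate under the command `u * aCirc`. -/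
noncomputable def turn (E : Engagement n) (i : Fin n) (u t : ℝ) : ℝ :=
  2 * u * E.V i / (E.along i t ^ 2 + E.across i t ^ 2)

/-- The heading rotates at the rate `turn * across`. Keeping `u` arbitrary lets the same equations
serve for `u = 0`, `u = 1` and sliding. -/
theorem ae_motion {G : ℝ → Digraph (Fin n)} (hkin : E.Kinematics) (hlaw : E.UnderGuidanceLaw G)
    (hT : E.InProgress T) :
    ∀ᵐ t : ℝ, t ∈ Ioo 0 T → GuidanceLaw (G t) (E.tEst t) (fun i => E.a i t) (E.aCirc t) ∧
      ∀ i u, E.a i t = u * E.aCirc t i →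
        HasDerivAt (E.along i) (-E.V i + E.turn i u t * E.across i t ^ 2) t ∧
        HasDerivAt (E.across i) (-(E.turn i u t * E.across i t * E.along i t)) t := by
  have hγ := ae_all_iff.2 hkin.deriv_γ
  filter_upwards [hγ, hlaw] with t hγ hlaw ht
  have hpt : E.InProgress t := hT.mono ht.2.le
  refine ⟨hlaw ht.1 hpt, fun i u hu => ?_⟩
  have hω : E.a i t / E.V i = E.turn i u t * E.across i t := by
    rw [hu, mul_div_assoc, aCirc_div, turn]
    ring
  have hx := hkin.deriv_x i t ht.1 hpt
  have hy := hkin.deriv_y i t ht.1 hpt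
  have hg := hγ i ht.1 hpt
  rw [hω] at hg
  exact ⟨(hasDerivAt_along hx hy hg).congr_deriv (by ring),
    (hasDerivAt_across hx hy hg).congr_deriv (by ring)⟩

section AbsolutelyContinuous

variable (hkin : E.Kinematics) (hT0 : 0 < T) (hT : E.InProgress T)
include hkin hT0 hT

theorem absCont_x (i : Fin n) : AbsolutelyContinuousOnInterval (E.x i) 0 T :=
  ((hkin.continuousOn_x i).mono Icc_subset_Ici_self).absolutelyContinuousOnInterval_of_hasDerivAt
    hT0.le (fun t ht => hkin.deriv_x i t ht.1 (hT.mono ht.2.le)) fun t _ => by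
      rw [abs_mul, abs_of_pos (E.V_pos i)]
      exact mul_le_of_le_one_right (E.V_pos i).le (Real.abs_cos_le_one _)

theorem absCont_y (i : Fin n) : AbsolutelyContinuousOnInterval (E.y i) 0 T :=
  ((hkin.continuousOn_y i).mono Icc_subset_Ici_self).absolutelyContinuousOnInterval_of_hasDerivAt
    hT0.le (fun t ht => hkin.deriv_y i t ht.1 (hT.mono ht.2.le)) fun t _ => by
      rw [abs_mul, abs_of_pos (E.V_pos i)]
      exact mul_le_of_le_one_right (E.V_pos i).le (Real.abs_sin_le_one _)

theorem absCont_cos_γ (i : Fin n) :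
    AbsolutelyContinuousOnInterval (fun t => Real.cos (E.γ i t)) 0 T :=
  (hkin.absCont_γ i T hT0 hT).comp_contDiffOn Real.contDiff_cos.contDiffOn

theorem absCont_sin_γ (i : Fin n) :
    AbsolutelyContinuousOnInterval (fun t => Real.sin (E.γ i t)) 0 T :=
  (hkin.absCont_γ i T hT0 hT).comp_contDiffOn Real.contDiff_sin.contDiffOn

theorem absCont_along (i : Fin n) : AbsolutelyContinuousOnInterval (E.along i) 0 T :=
  (((absCont_x hkin hT0 hT i).const_sub _).fun_mul (absCont_cos_γ hkin hT0 hT i)).fun_add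
    (((absCont_y hkin hT0 hT i).const_sub _).fun_mul (absCont_sin_γ hkin hT0 hT i))

theorem absCont_across (i : Fin n) : AbsolutelyContinuousOnInterval (E.across i) 0 T :=
  (((absCont_y hkin hT0 hT i).const_sub _).fun_mul (absCont_cos_γ hkin hT0 hT i)).fun_sub
    (((absCont_x hkin hT0 hT i).const_sub _).fun_mul (absCont_sin_γ hkin hT0 hT i))

theorem absCont_R_sq (i : Fin n) :
    AbsolutelyContinuousOnInterval (fun t => E.along i t ^ 2 + E.across i t ^ 2) 0 T := by
  have h := absCont_along hkin hT0 hT i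
  have h' := absCont_across hkin hT0 hT i
  exact ((h.fun_mul h).fun_add (h'.fun_mul h')).congr fun t _ => by ring

end AbsolutelyContinuous

theorem across_zero_ne_zero (hθ : E.θ i 0 ≠ 0 ∧ E.θ i 0 ≠ Real.pi) : E.across i 0 ≠ 0 := by
  intro h
  rw [θ_eq_arg, h] at hθ
  rcases le_or_gt 0 (E.along i 0) with h' | h'
  · exact hθ.1 (Complex.arg_ofReal_of_nonneg h')
  · exact hθ.2 (Complex.arg_ofReal_of_neg h')

/-- A pursuer keeps its line of sight off the line of its heading. -/
theorem across_ne_zero {G : ℝ → Digraph (Fin n)} (hkin : E.Kinematics)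
    (hlaw : E.UnderGuidanceLaw G) (h0 : E.across i 0 ≠ 0) (hT : E.InProgress T) (hT0 : 0 ≤ T) :
    E.across i T ≠ 0 := by
  rcases hT0.eq_or_lt with rfl | hT0
  · exact h0
  have hac := absCont_across hkin hT0 hT i
  have hal := absCont_along hkin hT0 hT i
  have hsq : ∀ t ∈ uIcc 0 T, E.along i t ^ 2 + E.across i t ^ 2 ≠ 0 := fun t ht => by
    rw [uIcc_of_le hT0.le] at ht
    rw [← R_sq]
    exact pow_ne_zero _ (R_pos (hT t ht i)).ne'
  -- `C` bounds `along / R ^ 2`, which is continuous on `[0, T]` because `R` does not vanish before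
  -- an interception.
  obtain ⟨C, hC⟩ := (hal.fun_mul ((absCont_R_sq hkin hT0 hT i).fun_inv hsq)).exists_bound
  have hV := E.V_pos i
  -- The derivative of `exp (K t) * across ^ 2` is that function times `K - 2 * turn * along`, and
  -- `turn * along ≤ 2 * V * C`.
  let K := 4 * E.V i * C
  have hexp : AbsolutelyContinuousOnInterval (fun t => Real.exp (K * t)) 0 T :=
    ContDiffOn.absolutelyContinuousOnInterval (by fun_prop)
  have hmono := (hexp.fun_mul (hac.fun_mul hac)).le_of_ae_deriv_nonneg hT0.le (by
    filter_upwards [ae_motion hkin hlaw hT] with t h ht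
    obtain ⟨hl, h⟩ := h ht
    obtain ⟨u, hu, hau⟩ := hl.exists_eq_mul i
    have hd := (h i u hau).2
    have hde : HasDerivAt (fun t => Real.exp (K * t)) (Real.exp (K * t) * (K * 1)) t :=
      ((hasDerivAt_id t).const_mul K).exp
    refine ⟨_, hde.mul (hd.mul hd), ?_⟩
    have hCt := hC t (by rw [uIcc_of_le hT0.le]; exact Ioo_subset_Icc_self ht)
    rw [Real.norm_eq_abs] at hCt
    have hk : E.turn i u t * E.along i t ≤ 2 * E.V i * C := by
      calc E.turn i u t * E.along i t
          = u * (2 * E.V i * (E.along i t * (E.along i t ^ 2 + E.across i t ^ 2)⁻¹)) := by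
            rw [turn]; ring
        _ ≤ u * (2 * E.V i * C) := by
            have := (le_abs_self _).trans hCt
            have := hu.1
            gcongr
        _ ≤ 1 * (2 * E.V i * C) := by
            have := (abs_nonneg _).trans hCt
            have := hu.2
            gcongr
        _ = _ := one_mul _
    have he := Real.exp_pos (K * t)
    have : 0 ≤ (2 * Real.exp (K * t) * E.across i t ^ 2) *
        (2 * E.V i * C - E.turn i u t * E.along i t) :=
      mul_nonneg (by positivity) (sub_nonneg.2 hk)
    refine this.trans_eq ?_
    simp only [K]
    ring)
  intro h
  simp only [h, mul_zero, Real.exp_zero, one_mul] at hmono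
  exact h0 (by nlinarith)

/-- The derivative of the estimated interception time along a motion with command `u * aCirc`. -/
theorem hasDerivAt_tEst {u : ℝ} (h0 : E.across i t ≠ 0)
    (hξ : HasDerivAt (E.along i) (-E.V i + E.turn i u t * E.across i t ^ 2) t)
    (hη : HasDerivAt (E.across i) (-(E.turn i u t * E.across i t * E.along i t)) t) :
    HasDerivAt (fun t => t + E.tEst t i) (2 * (1 - u) * (1 - (Real.pi / 2 -
      Real.arctan (E.along i t * |E.across i t|⁻¹)) * (E.along i t * |E.across i t|⁻¹))) t := by
  have hV := E.V_pos i
  have hev : ∀ᶠ r in nhds t, E.across i r ≠ 0 := hη.continuousAt.eventually_ne h0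
  have hpos : 0 < |E.across i t| := abs_pos.2 h0
  have hR : 0 < E.along i t ^ 2 + |E.across i t| ^ 2 := by positivity
  have habs : HasDerivAt (fun r => |E.across i r|)
      (-(E.turn i u t * |E.across i t| * E.along i t)) t := by
    refine ((hasDerivAt_abs h0).comp t hη).congr_deriv ?_
    rcases lt_or_gt_of_ne h0 with h | h
    · rw [abs_of_neg h]; simp [sign_neg h]
    · rw [abs_of_pos h]; simp [sign_pos h]
  have hinv := habs.fun_inv hpos.ne'
  have hat := ((hξ.fun_mul hinv).arctan).const_sub (Real.pi / 2)
  have hsq := (hξ.fun_pow 2).fun_add (hη.fun_pow 2)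
  have hz := (hasDerivAt_id t).fun_add (((hsq.fun_mul hat).fun_mul hinv).const_mul (E.V i)⁻¹)
  refine (hz.congr_of_eventuallyEq ?_).congr_deriv ?_
  · filter_upwards [hev] with r hr
    simp only [id, tEst_eq hr]
  -- Once the `arctan` is an opaque symbol, only an identity of rational functions remains.
  · generalize Real.arctan (E.along i t * |E.across i t|⁻¹) = α
    simp only [turn]
    have hsqa : E.across i t ^ 2 = |E.across i t| ^ 2 := (sq_abs _).symm
    have h3 : ∀ k a : ℝ, 2 * E.across i t * -(k * E.across i t * a) =
        -(2 * k * a * |E.across i t| ^ 2) := fun k a => by rw [← hsqa]; ring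
    generalize |E.across i t| = b at *
    generalize E.along i t = a at *
    simp only [Nat.cast_ofNat, Nat.add_one_sub_one, pow_one, h3, hsqa]
    have h1 : 1 + (a * b⁻¹) ^ 2 = (a ^ 2 + b ^ 2) * (b⁻¹) ^ 2 := by field_simp; ring
    rw [h1]
    field_simp
    ring

end Engagement
end Interception

/-! ### Evolution of the predicted arrival times -/

namespace Interception
namespace Engagement

variable {n : ℕ} {E : Engagement n} {G : ℝ → Digraph (Fin n)} {s t T : ℝ}

section Motion

variable (hkin : E.Kinematics) (hlaw : E.UnderGuidanceLaw G) (h0 : ∀ i, E.across i 0 ≠ 0)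
include hkin hlaw h0

theorem absCont_add_tEst (hT0 : 0 < T) (hT : E.InProgress T) (i : Fin n) :
    AbsolutelyContinuousOnInterval (fun t => t + E.tEst t i) 0 T := by
  have hne : ∀ t ∈ uIcc 0 T, E.across i t ≠ 0 := fun t ht => by
    rw [uIcc_of_le hT0.le] at ht
    exact across_ne_zero hkin hlaw (h0 i) (hT.mono ht.2) ht.1
  have hinv := (absCont_across hkin hT0 hT i).fun_abs.fun_inv fun t ht => abs_ne_zero.2 (hne t ht)
  have hat := (((absCont_along hkin hT0 hT i).fun_mul hinv).comp_contDiffOn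
    (g := Real.arctan) Real.contDiff_arctan.contDiffOn).const_sub (Real.pi / 2)
  have hid : AbsolutelyContinuousOnInterval (fun t : ℝ => t) 0 T :=
    ContDiffOn.absolutelyContinuousOnInterval (by fun_prop)
  refine (hid.fun_add ((((absCont_R_sq hkin hT0 hT i).fun_mul hat).fun_mul
    hinv).const_mul (E.V i)⁻¹)).congr fun t ht => ?_
  simp only [tEst_eq (hne t ht)]

/-- The sum of the time and of the estimated time to go never decreases. -/
theorem add_tEst_mono (i : Fin n) (hs : 0 ≤ s) (hst : s ≤ t) (ht : E.InProgress t) :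
    s + E.tEst s i ≤ t + E.tEst t i := by
  rcases hst.eq_or_lt with rfl | hlt
  · rfl
  have ht0 := hs.trans_lt hlt
  refine ((absCont_add_tEst hkin hlaw h0 ht0 ht i).mono ?_).le_of_ae_deriv_nonneg hst ?_
  · rw [uIcc_of_le hst, uIcc_of_le ht0.le]
    exact Icc_subset_Icc_left hs
  filter_upwards [ae_motion hkin hlaw ht] with r hr hrs
  obtain ⟨hl, h⟩ := hr ⟨hs.trans_lt hrs.1, hrs.2⟩
  obtain ⟨u, hu, hau⟩ := hl.exists_eq_mul i
  obtain ⟨hξ, hη⟩ := h i u hau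
  refine ⟨_, hasDerivAt_tEst (across_ne_zero hkin hlaw (h0 i) (ht.mono hrs.2.le)
    (hs.trans hrs.1.le)) hξ hη, ?_⟩
  have h1 := hu.2
  have h2 := Real.pi_div_two_sub_arctan_mul_le (E.along i r * |E.across i r|⁻¹)
  exact mul_nonneg (by linarith) (by linarith)

/-- The largest estimated time of arrival is constant. -/
theorem add_tEst_le_of_isLeader {l : Fin n} (hl : E.IsLeader l 0) (i : Fin n) (ht0 : 0 ≤ t)
    (ht : E.InProgress t) : t + E.tEst t i ≤ E.tEst 0 l := by
  rcases ht0.eq_or_lt with rfl | ht0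
  · simpa using hl i
  have hne : (Finset.univ : Finset (Fin n)).Nonempty := ⟨l, Finset.mem_univ l⟩
  have hac := AbsolutelyContinuousOnInterval.fun_sup' hne (absCont_add_tEst hkin hlaw h0 ht0 ht)
  have heq := hac.eq_of_ae_deriv_eq_zero ht0.le (by
    filter_upwards [ae_motion hkin hlaw ht, hac.ae_differentiableAt] with r hr hdiff hrt
    refine HasDerivAt.sup'_of_attained hne
      (hdiff (by rw [uIcc_of_le ht0.le]; exact Ioo_subset_Icc_self hrt)) fun i _ hi => ?_
    obtain ⟨hlw, h⟩ := hr hrt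
    have hau := hlw.eq_of_forall_le (i := i) fun j => by
      have := hi j (Finset.mem_univ j)
      linarith
    -- For `u = 1` the factor `1 - u` makes the derivative vanish.
    obtain ⟨hξ, hη⟩ := h i 1 (by rw [one_mul]; exact hau)
    simpa using hasDerivAt_tEst (across_ne_zero hkin hlaw (h0 i) (ht.mono hrt.2.le)
      hrt.1.le) hξ hη)
  calc t + E.tEst t i ≤ Finset.univ.sup' hne fun i => t + E.tEst t i :=
        Finset.le_sup' (fun i => t + E.tEst t i) (Finset.mem_univ i)
    _ = Finset.univ.sup' hne fun i => 0 + E.tEst 0 i := heq.symm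
    _ ≤ E.tEst 0 l := Finset.sup'_le _ _ fun j _ => by simpa using hl j

omit h0 in
/-- A pursuer that stays behind one of its out-neighbours flies straight. -/
theorem across_eq_of_behind {j k : Fin n} (hs : 0 ≤ s) (hst : s ≤ t) (ht : E.InProgress t)
    (hb : ∀ r ∈ Ioo s t, (G r).Adj j k ∧ E.tEst r j < E.tEst r k) :
    E.across j s = E.across j t := by
  rcases hst.eq_or_lt with rfl | hlt
  · rfl
  have ht0 := hs.trans_lt hlt
  refine ((absCont_across hkin ht0 ht j).mono ?_).eq_of_ae_deriv_eq_zero hst ?_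
  · rw [uIcc_of_le hst, uIcc_of_le ht0.le]
    exact Icc_subset_Icc_left hs
  filter_upwards [ae_motion hkin hlaw ht] with r hr hrs
  obtain ⟨hl, h⟩ := hr ⟨hs.trans_lt hrs.1, hrs.2⟩
  have ha := hl.1 j ⟨k, hb r hrs⟩
  simpa [turn] using (h j 0 (by simpa using ha)).2

/-- A pursuer cannot stay behind an out-neighbour until the very end of its estimated flight. -/
theorem not_behind_until {j k : Fin n} (hs : 0 ≤ s) (hst : s < T)
    (hp : ∀ t < T, E.InProgress t) (hj : ∀ t ∈ Ico 0 T, t + E.tEst t j ≤ T)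
    (hb : ∀ r ∈ Ioo s T, (G r).Adj j k ∧ E.tEst r j < E.tEst r k) : False := by
  have hne := across_ne_zero hkin hlaw (h0 j) (hp s hst) hs
  have hpos := abs_pos.2 hne
  have hV := E.V_pos j
  have hle : ∀ t ∈ Ico s T, |E.across j s| ≤ E.V j * (T - t) := fun t ht => by
    rw [across_eq_of_behind hkin hlaw hs ht.1 (hp t ht.2)
      fun r hr => hb r ⟨hr.1, hr.2.trans ht.2⟩]
    have ht0 := hs.trans ht.1
    have h1 := R_le_mul_tEst (across_ne_zero hkin hlaw (h0 j) (hp t ht.2) ht0)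
    have h2 := hj t ⟨ht0, ht.2⟩
    refine abs_across_le.trans (h1.trans ?_)
    gcongr
    linarith
  -- At time `T - d` the bound gives `|across| ≤ V * d ≤ |across| / 2`.
  let d := min (T - s) (|E.across j s| / (2 * E.V j))
  have hd : 0 < d := lt_min (by linarith) (by positivity)
  have h1 := hle (T - d) ⟨by have := min_le_left (T - s) (|E.across j s| / (2 * E.V j)); linarith,
    by linarith⟩
  have h2 : d ≤ |E.across j s| / (2 * E.V j) := min_le_right _ _
  rw [le_div_iff₀ (by positivity)] at h2
  nlinarith

/-- A pursuer reaching the target at time `T` estimated its arrival at `T` or earlier. -/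
theorem add_tEst_le_of_atTarget {i : Fin n} (hT : 0 < T) (hp : ∀ t < T, E.InProgress t)
    (hi : E.AtTarget i T) (ht : t ∈ Ico 0 T) : t + E.tEst t i ≤ T := by
  by_contra! hlt
  have hV := E.V_pos i
  have hne : ∀ r ∈ Ico 0 T, E.across i r ≠ 0 := fun r hr =>
    across_ne_zero hkin hlaw (h0 i) (hp r hr.2) hr.1
  let d := t + E.tEst t i - T
  have hd : 0 < d := sub_pos.2 hlt
  -- By monotonicity the excess over `T` persists, so `tEst` stays away from zero although `R` tends
  -- to zero.
  have hgap : ∀ r ∈ Ico t T, d ≤ E.tEst r i := fun r hr => by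
    have := add_tEst_mono hkin hlaw h0 i ht.1 hr.1 (hp r hr.2)
    have := hr.2
    simp only [d]
    linarith
  have hcont : ContinuousOn (fun r => (E.xT - E.x i r) ^ 2 + (E.yT - E.y i r) ^ 2) (Icc 0 T) := by
    have hx := (hkin.continuousOn_x i).mono (Icc_subset_Ici_self : Icc 0 T ⊆ Ici 0)
    have hy := (hkin.continuousOn_y i).mono (Icc_subset_Ici_self : Icc 0 T ⊆ Ici 0)
    fun_prop
  have hRT : (E.xT - E.x i T) ^ 2 + (E.yT - E.y i T) ^ 2 = 0 := by
    rw [hi.1, hi.2]; ring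
  -- close to the target, the pursuer must be flying away from it
  obtain ⟨c, hc, hsmall⟩ : ∃ c ∈ Ico t T, ∀ r ∈ Ico c T, Real.pi / 2 * E.R i r < E.V i * d := by
    have hev : ∀ᶠ r in nhdsWithin T (Icc 0 T), (E.xT - E.x i r) ^ 2 + (E.yT - E.y i r) ^ 2 <
        (E.V i * d / (Real.pi / 2)) ^ 2 :=
      (hcont T ⟨hT.le, le_rfl⟩).eventually (gt_mem_nhds (by simp only [hRT]; positivity))
    rw [eventually_nhdsWithin_iff, Metric.eventually_nhds_iff] at hev
    obtain ⟨ε, hε, hev⟩ := hev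
    refine ⟨max t (T - ε / 2), ⟨le_max_left _ _, max_lt ht.2 (by linarith)⟩, fun r hr => ?_⟩
    have h1 := (le_max_left _ _).trans hr.1
    have h2 := (le_max_right _ _).trans hr.1
    have h3 := hev (y := r) (by rw [Real.dist_eq, abs_lt]; constructor <;> linarith [hr.2])
      ⟨ht.1.trans h1, hr.2.le⟩
    rw [← along_sq_add_across_sq, ← R_sq] at h3
    have h4 := lt_of_pow_lt_pow_left₀ 2 (by positivity) h3
    rwa [lt_div_iff₀ (by positivity), mul_comm] at h4
  -- Otherwise `V * tEst ≤ π / 2 * R < V * d ≤ V * tEst`.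
  have halong : ∀ r ∈ Ico c T, E.along i r ≤ 0 := fun r hr => by
    by_contra! hpos
    have hrt : r ∈ Ico t T := ⟨hc.1.trans hr.1, hr.2⟩
    have h1 := tEst_le_of_along_pos (hne r ⟨ht.1.trans hrt.1, hr.2⟩) hpos
    have h2 := hsmall r hr
    have h3 := hgap r hrt
    nlinarith
  -- Thus `R ^ 2`, of derivative `-2 * V * along`, cannot decrease from its positive value at `c` to
  -- zero at `T`.
  have hmono : MonotoneOn (fun r => (E.xT - E.x i r) ^ 2 + (E.yT - E.y i r) ^ 2) (Icc c T) := by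
    refine monotoneOn_of_hasDerivWithinAt_nonneg (convex_Icc c T)
      (f' := fun r => -2 * E.V i * E.along i r)
      (hcont.mono (Icc_subset_Icc_left (ht.1.trans hc.1))) ?_ ?_
    · intro r hr
      rw [interior_Icc] at hr
      have hr0 : 0 < r := (ht.1.trans hc.1).trans_lt hr.1
      have hx := (hkin.deriv_x i r hr0 (hp r hr.2)).const_sub E.xT
      have hy := (hkin.deriv_y i r hr0 (hp r hr.2)).const_sub E.yT
      refine (((hx.fun_pow 2).fun_add (hy.fun_pow 2)).congr_deriv ?_).hasDerivWithinAt
      simp only [along, Nat.cast_ofNat, Nat.add_one_sub_one, pow_one]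
      ring
    · intro r hr
      rw [interior_Icc] at hr
      have := halong r ⟨hr.1.le, hr.2⟩
      nlinarith
  have hle := hmono ⟨le_rfl, hc.2.le⟩ ⟨hc.2.le, le_rfl⟩ hc.2.le
  simp only [hRT] at hle
  rw [← along_sq_add_across_sq, ← R_sq] at hle
  have := R_pos_of_across (hne c ⟨ht.1.trans hc.1, hc.2⟩)
  nlinarith

end Motion

end Engagement
end Interception

/-! ### Sinks, switching graphs and losses of reachability -/

namespace Interception

section Graphs

variable {V : Type} {G : Digraph V}

theorem mem_condFiber_mk {i j : V} :
    j ∈ condFiber G (Quotient.mk (sccSetoid G) i) ↔ Reach G j i ∧ Reach G i j :=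
  Quotient.eq (r := sccSetoid G)

/-- From every node of a finite digraph one can reach a sink of the condensation graph. -/
theorem exists_reach_sink [Finite V] (i : V) :
    ∃ k ∈ sinksSingletons G, ∀ s ∈ condFiber G k, Reach G i s := by
  -- A node reachable from `i` that itself reaches as few nodes as possible lies in a sink: whatever
  -- it reaches must reach it back.
  obtain ⟨p, hp, hmin⟩ := exists_min_image {p | Reach G i p} (fun p => {q | Reach G p q}.ncard)
    (toFinite _) ⟨i, Relation.ReflTransGen.refl⟩
  have hback : ∀ q, Reach G p q → Reach G q p := fun q hq => by
    have hsub : {r | Reach G q r} ⊆ {r | Reach G p r} := fun r hr => hq.trans hr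
    have heq := eq_of_subset_of_ncard_le hsub (hmin q (hp.trans hq)) (toFinite _)
    have : p ∈ {r | Reach G q r} := heq ▸ (Relation.ReflTransGen.refl : Reach G p p)
    exact this
  refine ⟨Quotient.mk (sccSetoid G) p, Or.inl ?_, fun s hs => ?_⟩
  · rintro k' ⟨hne, q, hq, r, hr, hadj⟩
    rw [mem_condFiber_mk] at hq
    have hpr : Reach G p r := hq.2.tail hadj
    have hr' : r ∈ condFiber G (Quotient.mk (sccSetoid G) p) :=
      mem_condFiber_mk.2 ⟨hback r hpr, hpr⟩
    exact hne (hr'.symm.trans hr)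
  · exact Relation.ReflTransGen.trans hp (mem_condFiber_mk.1 hs).2

/-- If no new sinks are created, every node can still reach a former local leader. -/
theorem NoNewSinks.exists_reach_localLeader [Finite V] {G' : Digraph V} (h : NoNewSinks G G')
    (τ : V → ℝ) (i : V) : ∃ s ∈ localLeaders G τ, Reach G' i s := by
  obtain ⟨k', hk', hr⟩ := exists_reach_sink (G := G') i
  obtain ⟨k, hk, hsub⟩ := h k' hk'
  obtain ⟨j, rfl⟩ := Quotient.exists_rep k
  obtain ⟨s, hs, hmax⟩ := exists_max_image (condFiber G (Quotient.mk (sccSetoid G) j)) τ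
    (toFinite _) ⟨j, rfl⟩
  exact ⟨s, ⟨_, hk, hs, hmax⟩, hr s (hsub hs)⟩

theorem Reach.mem_of_closed {I : Set V} {i s : V} (h : Reach G i s) (hi : i ∈ I)
    (hI : ∀ j ∈ I, ∀ k ∉ I, ¬ G.Adj j k) : s ∈ I := by
  induction h with
  | refl => exact hi
  | tail _ hjk ih =>
    by_contra hk
    exact hI _ ih _ hk hjk

/-- A switching graph is constant on some interval preceding any given positive time. -/
theorem IsSwitching.exists_const_before {G : ℝ → Digraph V} (hG : IsSwitching G) {T : ℝ}
    (hT : 0 < T) : ∃ c ∈ Ico 0 T, ∀ s ∈ Ioo c T, ∀ t ∈ Ioo c T, G s = G t := by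
  obtain ⟨F, hF⟩ := hG T
  -- `c` is the last listed instant in `[0, T)`, or `0` if there is none. A switch at `T` itself is
  -- harmless.
  obtain ⟨c, hc, hmax⟩ := (insert (0 : ℝ) (F.filter fun r => r ∈ Ico 0 T)).exists_max_image id
    (Finset.insert_nonempty _ _)
  have hc' : c ∈ Ico 0 T := by
    rcases Finset.mem_insert.1 hc with rfl | hc
    · exact ⟨le_rfl, hT⟩
    · exact (Finset.mem_filter.1 hc).2
  have key : ∀ s ∈ Ioo c T, ∀ t ∈ Ioo c T, s ≤ t → G s = G t := fun s hs t ht hst => by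
    refine hF s t (hc'.1.trans hs.1.le) hst ht.2.le fun r hr hsr => ?_
    have := hmax r (Finset.mem_insert_of_mem (Finset.mem_filter.2
      ⟨hr, (hc'.1.trans hs.1.le).trans hsr.1.le, hsr.2.trans_lt ht.2⟩))
    simp only [id] at this
    linarith [hs.1, hsr.1]
  refine ⟨c, hc', fun s hs t ht => ?_⟩
  rcases le_total s t with h | h
  · exact key s hs t ht h
  · exact (key t ht s hs h).symm

namespace IsLossSequence

variable {G : ℝ → Digraph V} {l : V} {N : ℕ∞} {t δ : ℕ → ℝ}

theorem end_lt (h : IsLossSequence G l N t δ) {m k : ℕ} (hmk : m < k) (hk : (k : ℕ∞) < N) :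
    t m + δ m < t k := by
  induction k, hmk using Nat.le_induction with
  | base => exact h.lt_next m hk
  | succ k hmk ih =>
    have hk' : (k : ℕ∞) < N := lt_of_le_of_lt (by exact_mod_cast k.le_succ) hk
    have h1 := ih hk'
    have h2 := h.lt_next k hk
    have h3 := h.duration_pos k hk'
    linarith

/-- At the end of a loss, global reachability is recovered. -/
theorem globallyReachable_end (h : IsLossSequence G l N t δ) {m : ℕ} (hm : (m : ℕ∞) < N) :
    GloballyReachable (G (t m + δ m)) l := by
  have hpos := h.duration_pos m hm
  have h0 := h.nonneg m hm
  refine h.connected _ (by linarith) fun k hk hmem => ?_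
  rcases lt_trichotomy m k with hmk | rfl | hmk
  · linarith [h.end_lt hmk hk, hmem.1]
  · linarith [hmem.2]
  · linarith [h.end_lt hmk hm, hmem.2]

/-- Just before any time, either the leader is globally reachable or a single loss is under way. -/
theorem before (h : IsLossSequence G l N t δ) {c T : ℝ} (hc : 0 ≤ c)
    (hconst : ∀ s ∈ Ioo c T, ∀ r ∈ Ioo c T, G s = G r) :
    ∀ s ∈ Ioo c T, GloballyReachable (G s) l ∨
      ∃ m : ℕ, (m : ℕ∞) < N ∧ s ∈ Ico (t m) (t m + δ m) ∧ T ≤ t m + δ m := by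
  intro s hs
  by_cases hr : GloballyReachable (G s) l
  · exact Or.inl hr
  have : ∃ m : ℕ, (m : ℕ∞) < N ∧ s ∈ Ico (t m) (t m + δ m) := by
    by_contra! hno
    exact hr (h.connected s (hc.trans hs.1.le) hno)
  obtain ⟨m, hm, hsm⟩ := this
  refine Or.inr ⟨m, hm, hsm, ?_⟩
  -- A loss ending before `T` would restore reachability within the interval where the graph is
  -- constant.
  by_contra! hlt
  exact hr (hconst _ hs _ ⟨hs.1.trans hsm.2, hlt⟩ ▸ h.globallyReachable_end hm)

end IsLossSequence

end Graphs

/-! ### No early interception, consensus and simultaneous arrival -/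

namespace Engagement

variable {n : ℕ} {E : Engagement n} {G : ℝ → Digraph (Fin n)}

/-- Shortly before the time `T`, there is no edge leaving a set of pursuers whose estimated
arrivals are at most `T` and that end up behind all others. -/
theorem exists_no_edge_before (hkin : E.Kinematics) (hlaw : E.UnderGuidanceLaw G)
    (h0 : ∀ i, E.across i 0 ≠ 0) {c T : ℝ} (hc : c ∈ Ico 0 T)
    (hconst : ∀ s ∈ Ioo c T, ∀ t ∈ Ioo c T, G s = G t) (hp : ∀ t < T, E.InProgress t)
    {I : Set (Fin n)} (hI : ∀ j ∈ I, ∀ t ∈ Ico 0 T, t + E.tEst t j ≤ T)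
    (hIc : ∀ j ∈ I, ∀ k ∉ I, ∃ d ∈ Ico 0 T, ∀ t ∈ Ioo d T, E.tEst t j < E.tEst t k) :
    ∀ t ∈ Ioo c T, ∀ j ∈ I, ∀ k ∉ I, ¬ (G t).Adj j k := by
  intro t ht j hj k hk hadj
  obtain ⟨d, hd, hlt⟩ := hIc j hj k hk
  refine not_behind_until hkin hlaw h0 (k := k) (hc.1.trans (le_max_left c d))
    (max_lt hc.2 hd.2) hp (hI j hj) fun r hr => ?_
  have h1 := (le_max_left c d).trans_lt hr.1
  have h2 := (le_max_right c d).trans_lt hr.1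
  exact ⟨hconst t ht r ⟨h1, hr.2⟩ ▸ hadj, hlt r ⟨h2, hr.2⟩⟩

section Losses

variable (hθ : ∀ i, E.θ i 0 ≠ 0 ∧ E.θ i 0 ≠ Real.pi) (hG : IsSwitching G)
  (hkin : E.Kinematics) (hlaw : E.UnderGuidanceLaw G) {l : Fin n} (hl : E.IsLeader l 0)
  {N : ℕ∞} {t δ : ℕ → ℝ} (ht : IsLossSequence G l N t δ)
  (hsinks : ∀ m : ℕ, (m : ℕ∞) < N → E.InProgress (t m) →
    ∀ s ∈ Ico (t m) (t m + δ m), NoNewSinks (G (t m)) (G s))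
  {f : ℕ → Fin n}
  (hf : ∀ m : ℕ, (m : ℕ∞) < N → E.InProgress (t m) →
    IsFirstInterceptor (G (t m)) (E.tEst (t m)) (f m))
  (hδ : ∀ m : ℕ, (m : ℕ∞) < N → E.InProgress (t m) → δ m < E.tEst (t m) (f m))

include hθ hkin hlaw ht hsinks hf hδ in
/-- Shortly before a time without previous interceptions, either the leader is globally reachable
or every pursuer can reach one whose estimated arrival is later than that time. -/
theorem reach_before {c T : ℝ} (hc : c ∈ Ico 0 T)
    (hconst : ∀ s ∈ Ioo c T, ∀ t ∈ Ioo c T, G s = G t) (hp : ∀ t < T, E.InProgress t) :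
    ∀ s ∈ Ioo c T, GloballyReachable (G s) l ∨
      ∀ i, ∃ j, Reach (G s) i j ∧ T < s + E.tEst s j := by
  intro s hs
  refine (ht.before hc.1 hconst s hs).imp_right ?_
  rintro ⟨m, hm, hsm, hT⟩ i
  have hpm : E.InProgress (t m) := (hp s hs.2).mono hsm.1
  obtain ⟨j, hj, hij⟩ := (hsinks m hm hpm s hsm).exists_reach_localLeader (E.tEst (t m)) i
  refine ⟨j, hij, ?_⟩
  -- Chain: `T ≤ t m + δ m < t m + tEst (t m) (f m) ≤ t m + tEst (t m) j ≤ s + tEst s j`.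
  have h1 := (hf m hm hpm).2 j hj
  have h2 := hδ m hm hpm
  have h3 := add_tEst_mono hkin hlaw (fun i => across_zero_ne_zero (hθ i)) j (ht.nonneg m hm)
    hsm.1 (hp s hs.2)
  linarith

include hθ hG hkin hlaw ht hsinks hf hδ

/-- Nobody is the first to reach the target before the time estimated by the leader. -/
theorem not_atTarget_first {T : ℝ} (hT0 : 0 < T) (hT : T < E.tEst 0 l)
    (hp : ∀ t < T, E.InProgress t) (i : Fin n) : ¬ E.AtTarget i T := by
  intro hi
  have h0 : ∀ i, E.across i 0 ≠ 0 := fun i => across_zero_ne_zero (hθ i)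
  obtain ⟨c, hc, hconst⟩ := hG.exists_const_before hT0
  let I : Set (Fin n) := {j | ∀ t ∈ Ico 0 T, t + E.tEst t j ≤ T}
  have hiI : i ∈ I := fun t ht => add_tEst_le_of_atTarget hkin hlaw h0 hT0 hp hi ht
  have hedge := exists_no_edge_before hkin hlaw h0 hc hconst hp (I := I) (fun j hj => hj) (by
    intro j hj k hk
    -- Outside `I`, the predicted arrival exceeds `T` at some time, hence ever after until `T`.
    simp only [I, mem_ofPred_eq, not_forall, not_le] at hk
    obtain ⟨d, hd, hlt⟩ := hk
    refine ⟨d, hd, fun r hr => ?_⟩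
    have h1 := hj r ⟨hd.1.trans hr.1.le, hr.2⟩
    have h2 := add_tEst_mono hkin hlaw h0 k hd.1 hr.1.le (hp r hr.2)
    linarith)
  obtain ⟨s, hs⟩ := exists_between hc.2
  have hs0 : s ∈ Ico 0 T := ⟨hc.1.trans hs.1.le, hs.2⟩
  have hreach : ∃ j, Reach (G s) i j ∧ T < s + E.tEst s j := by
    rcases reach_before hθ hkin hlaw ht hsinks hf hδ hc hconst hp s hs with h | h
    · refine ⟨l, h i, ?_⟩
      have := add_tEst_mono hkin hlaw h0 l le_rfl hs0.1 (hp s hs.2)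
      linarith
    · exact h i
  obtain ⟨j, hj, hlt⟩ := hreach
  exact absurd (hj.mem_of_closed hiI (hedge s hs) s hs0) (not_le.2 hlt)

/-- Finitely many continuous paths make the set of interception times closed, so a first one exists
and `not_atTarget_first` excludes it. -/
theorem inProgress_before (hstart : ∀ i, ¬ E.AtTarget i 0) {s : ℝ} (hs : s < E.tEst 0 l) :
    E.InProgress s := by
  by_contra hno
  have hclosed : IsClosed {r | r ∈ Ici (0 : ℝ) ∧ ∃ i, E.AtTarget i r} := by
    have : {r | r ∈ Ici (0 : ℝ) ∧ ∃ i, E.AtTarget i r} =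
        ⋃ i, {r | r ∈ Ici (0 : ℝ) ∧ E.x i r = E.xT} ∩ {r | r ∈ Ici (0 : ℝ) ∧ E.y i r = E.yT} := by
      ext r
      simp only [mem_ofPred_eq, mem_iUnion, mem_inter_iff, AtTarget]
      constructor
      · rintro ⟨hr, i, hi⟩
        exact ⟨i, ⟨hr, hi.1⟩, hr, hi.2⟩
      · rintro ⟨i, hi, hi'⟩
        exact ⟨hi.1, i, hi.2, hi'.2⟩
    rw [this]
    exact isClosed_iUnion_of_finite fun i =>
      ((hkin.continuousOn_x i).preimage_isClosed_of_isClosed isClosed_Ici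
        (isClosed_singleton (x := E.xT))).inter
      ((hkin.continuousOn_y i).preimage_isClosed_of_isClosed isClosed_Ici
        (isClosed_singleton (x := E.yT)))
  simp only [InProgress, not_forall, not_not] at hno
  obtain ⟨r, hr, i, hi⟩ := hno
  have hbdd : BddBelow {r | r ∈ Ici (0 : ℝ) ∧ ∃ i, E.AtTarget i r} := ⟨0, fun r hr => hr.1⟩
  obtain ⟨hT0, j, hj⟩ := hclosed.csInf_mem ⟨r, hr.1, i, hi⟩ hbdd
  have hle := csInf_le hbdd ⟨hr.1, i, hi⟩
  set T := sInf {r | r ∈ Ici (0 : ℝ) ∧ ∃ i, E.AtTarget i r} with hTdef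
  have hTpos : 0 < T := lt_of_le_of_ne hT0 fun h => hstart j (h ▸ hj)
  refine not_atTarget_first hθ hG hkin hlaw ht hsinks hf hδ hTpos
    (hle.trans_lt (hr.2.trans_lt hs)) (fun r hr q hq k hk => ?_) j hj
  have := csInf_le hbdd ⟨hq.1, k, hk⟩
  linarith [hq.2]

include hl in
/-- Every pursuer eventually agrees with the leader. -/
theorem exists_agreement (hp : ∀ s < E.tEst 0 l, E.InProgress s) (i : Fin n) :
    ∃ c ∈ Ico 0 (E.tEst 0 l), ∀ s ∈ Ico c (E.tEst 0 l), s + E.tEst s i = E.tEst 0 l := by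
  have h0 : ∀ i, E.across i 0 ≠ 0 := fun i => across_zero_ne_zero (hθ i)
  have hle : ∀ i, ∀ s ∈ Ico 0 (E.tEst 0 l), s + E.tEst s i ≤ E.tEst 0 l := fun i s hs =>
    add_tEst_le_of_isLeader hkin hlaw h0 hl i hs.1 (hp s hs.2)
  -- A pursuer outside `J` has reached the maximal predicted arrival, and monotonicity keeps it
  -- there.
  let J : Set (Fin n) := {i | ∀ s ∈ Ico 0 (E.tEst 0 l), s + E.tEst s i < E.tEst 0 l}
  have hJc : ∀ i ∉ J, ∃ c ∈ Ico 0 (E.tEst 0 l), ∀ s ∈ Ico c (E.tEst 0 l),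
      s + E.tEst s i = E.tEst 0 l := fun i hi => by
    simp only [J, mem_ofPred_eq, not_forall, not_lt] at hi
    obtain ⟨c, hc, hce⟩ := hi
    exact ⟨c, hc, fun s hs => (hle i s ⟨hc.1.trans hs.1, hs.2⟩).antisymm
      (hce.trans (add_tEst_mono hkin hlaw h0 i hc.1 hs.1 (hp s hs.2)))⟩
  refine hJc i fun hi => ?_
  have hT0 : 0 < E.tEst 0 l := tEst_pos (h0 l)
  obtain ⟨c, hc, hconst⟩ := hG.exists_const_before hT0
  have hedge := exists_no_edge_before hkin hlaw h0 hc hconst hp (I := J)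
    (fun j hj s hs => (hj s hs).le) (by
      intro j hj k hk
      obtain ⟨d, hd, hde⟩ := hJc k hk
      refine ⟨d, hd, fun r hr => ?_⟩
      have h1 := hj r ⟨hd.1.trans hr.1.le, hr.2⟩
      have h2 := hde r ⟨hr.1.le, hr.2⟩
      linarith)
  obtain ⟨s, hs⟩ := exists_between hc.2
  have hs0 : s ∈ Ico 0 (E.tEst 0 l) := ⟨hc.1.trans hs.1.le, hs.2⟩
  rcases reach_before hθ hkin hlaw ht hsinks hf hδ hc hconst hp s hs with h | h
  -- A path to `l` would put `l` in `J`, but its predicted arrival never falls below `tEst 0 l`.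
  · have h1 := (h i).mem_of_closed hi (hedge s hs) s hs0
    have h2 := add_tEst_mono hkin hlaw h0 l le_rfl hs0.1 (hp s hs.2)
    linarith
  · obtain ⟨j, -, hj⟩ := h i
    exact absurd (hle j s hs0) (not_le.2 hj)

include hl in
omit ht hsinks hf hδ hG in
theorem atTarget_at_leader_time (hp : ∀ s < E.tEst 0 l, E.InProgress s) (i : Fin n) :
    E.AtTarget i (E.tEst 0 l) := by
  have h0 : ∀ i, E.across i 0 ≠ 0 := fun i => across_zero_ne_zero (hθ i)
  have hT0 : 0 < E.tEst 0 l := tEst_pos (h0 l)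
  have hV := E.V_pos i
  have hR : ContinuousOn (E.R i) (Icc 0 (E.tEst 0 l)) := by
    have hx := (hkin.continuousOn_x i).mono (Icc_subset_Ici_self : Icc 0 (E.tEst 0 l) ⊆ Ici 0)
    have hy := (hkin.continuousOn_y i).mono (Icc_subset_Ici_self : Icc 0 (E.tEst 0 l) ⊆ Ici 0)
    unfold R
    fun_prop
  have hbound : ∀ s ∈ Ico 0 (E.tEst 0 l), E.R i s ≤ E.V i * (E.tEst 0 l - s) := fun s hs => by
    refine (R_le_mul_tEst (across_ne_zero hkin hlaw (h0 i) (hp s hs.2) hs.1)).trans ?_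
    have := add_tEst_le_of_isLeader hkin hlaw h0 hl i hs.1 (hp s hs.2)
    gcongr
    linarith
  have hle := ContinuousWithinAt.closure_le (s := Ico 0 (E.tEst 0 l)) (x := E.tEst 0 l)
    (by rw [closure_Ico hT0.ne]; exact ⟨hT0.le, le_rfl⟩)
    ((hR _ ⟨hT0.le, le_rfl⟩).mono Ico_subset_Icc_self)
    (g := fun s => E.V i * (E.tEst 0 l - s)) (by fun_prop) hbound
  rw [sub_self, mul_zero] at hle
  exact R_eq_zero_iff.1 (hle.antisymm R_nonneg)

end Losses

end Engagement

end Interception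

theorem mainTheorem3 {n : ℕ} (E : Interception.Engagement n)
    (hstart : ∀ i, ¬ E.AtTarget i 0)
    (hθ : ∀ i, E.θ i 0 ≠ 0 ∧ E.θ i 0 ≠ Real.pi)
    (G : ℝ → Digraph (Fin n)) (hG : Interception.IsSwitching G)
    (hkin : E.Kinematics) (hlaw : E.UnderGuidanceLaw G)
    (l : Fin n) (hl : E.IsLeader l 0)
    (N : ℕ∞) (t δ : ℕ → ℝ) (ht : Interception.IsLossSequence G l N t δ)
    (hsinks : ∀ m : ℕ, (m : ℕ∞) < N → E.InProgress (t m) →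
      ∀ s ∈ Set.Ico (t m) (t m + δ m), Interception.NoNewSinks (G (t m)) (G s))
    (f : ℕ → Fin n)
    (hf : ∀ m : ℕ, (m : ℕ∞) < N → E.InProgress (t m) →
      Interception.IsFirstInterceptor (G (t m)) (E.tEst (t m)) (f m))
    (hδ : ∀ m : ℕ, (m : ℕ∞) < N → E.InProgress (t m) → δ m < E.tEst (t m) (f m)) :
    -- consensus in finite time, before the interception
    (∃ tc : ℝ, 0 ≤ tc ∧ tc < E.tEst 0 l ∧
      ∀ s ∈ Set.Ico tc (E.tEst 0 l), ∀ i j, E.tEst s i = E.tEst s j) ∧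
    -- simultaneous interception at the time estimated by the leader
    (∀ s ∈ Set.Ico 0 (E.tEst 0 l), ∀ i, ¬ E.AtTarget i s) ∧
    (∀ i, E.AtTarget i (E.tEst 0 l)) := by
  have hp : ∀ s < E.tEst 0 l, E.InProgress s := fun s hs =>
    Interception.Engagement.inProgress_before hθ hG hkin hlaw ht hsinks hf hδ hstart hs
  refine ⟨?_, fun s hs i => hp s hs.2 s ⟨hs.1, le_rfl⟩ i,
    Interception.Engagement.atTarget_at_leader_time hθ hkin hlaw hl hp⟩
  choose c hc hce using
    Interception.Engagement.exists_agreement hθ hG hkin hlaw hl ht hsinks hf hδ hp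
  -- The consensus time is the latest of the finitely many individual agreement times.
  obtain ⟨k, -, hk⟩ := Finset.univ.exists_max_image c ⟨l, Finset.mem_univ l⟩
  refine ⟨c k, (hc k).1, (hc k).2, fun s hs i j => ?_⟩
  have h1 := hce i s ⟨(hk i (Finset.mem_univ i)).trans hs.1, hs.2⟩
  have h2 := hce j s ⟨(hk j (Finset.mem_univ j)).trans hs.1, hs.2⟩
  linarith
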